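/- For a graph $G$, let $k_t(G)$ denote the number of $t$-element vertex sets of $G$ that induce a complete graph, and let $P_k$ denote the path with $k$ vertices. A graph is $P_k$-free if it contains no (not necessarily induced) copy of $P_k$. All graphs are finite and simple; $qK_{k-1}\cup L$ denotes the vertex-disjoint union of $q$ copies of the complete graph $K_{k-1}$ and the graph $L$. Let $n\ge 1$ and $3\le t<k$ be integers, and write $n=q(k-1)+r$ with integers $q\ge 0$ and $0\le r\le k-2$. Let $G$ be a graph on $n$ vertices. 1. If $G$ is $P_k$-free, then $k_t(G)\le k_t(qK_{k-1}\cup K_r)$. 2. If $t\le r$, then $G$ is $P_k$-free and satisfies $k_t(G)=k_t(qK_{k-1}\cup K_r)$ if and only if $G$ is isomorphic to $qK_{k-1}\cup K_r$. 3. If $t>r$, then $G$ is extremal (that is, $G$ is $P_k$-free and $k_t(G)\ge k_t(H)$ for every $P_k$-free graph $H$ on $n$ vertices) if and only if $G$ is isomorphic to $qK_{k-1}\cup L$ for some graph $L$ on $r$ vertices. -/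

import Mathlib

open SimpleGraph

/-- `k_t(G)`: the number of `t`-element vertex sets of `G` that induce a complete graph.
Only used for graphs on a finite vertex set, where `Set.ncard` is the true cardinality. -/
noncomputable def numCliques {V : Type*} (t : ℕ) (G : SimpleGraph V) : ℕ :=
  (G.cliqueSet t).ncard

/-- `G` is `P_k`-free: it contains no (not necessarily induced) copy of the path with `k`
vertices. -/
def PathFree {V : Type*} (k : ℕ) (G : SimpleGraph V) : Prop :=
  (pathGraph k).Free G

/-- `q H`: the vertex-disjoint union of `q` copies of the graph `H`. -/
def disjointCopies {W : Type*} (q : ℕ) (H : SimpleGraph W) : SimpleGraph (Fin q × W) where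
  Adj x y := x.1 = y.1 ∧ H.Adj x.2 y.2
  symm := ⟨fun _ _ h => ⟨h.1.symm, h.2.symm⟩⟩
  loopless := ⟨fun _ h => H.irrefl h.2⟩

/-- `q K_{k-1} ∪ L`: the vertex-disjoint union of `q` copies of the complete graph on `k - 1`
vertices and of the graph `L`. -/
def cliquesUnion {W : Type*} (q k : ℕ) (L : SimpleGraph W) :
    SimpleGraph ((Fin q × Fin (k - 1)) ⊕ W) :=
  disjointCopies q (completeGraph (Fin (k - 1))) ⊕g L

/-- `G` is extremal: it is `P_k`-free and has the largest number of `t`-cliques among all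
`P_k`-free graphs on its vertex set. -/
def IsPathExtremal {V : Type*} (t k : ℕ) (G : SimpleGraph V) : Prop :=
  PathFree k G ∧ ∀ H : SimpleGraph V, PathFree k H → numCliques t H ≤ numCliques t G

/-! Write f(n) for `cliqueBound t (k - 1) n`. Convexity of binomial coefficients makes f
superadditive, strictly so when two arguments below k - 1 have sum at least k - 1. Cutting off a
component therefore reduces the bound to connected graphs. Those with n < k have at most C(n,t) =
f(n) cliques; those with n ≥ k stay strictly below f(n) (`numCliques_lt_cliqueBound`). Hence
equality with n ≥ k - 1 forces a component K_{k-1}, and splitting such components off one at a time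
gives the extremal graphs.

The connected case n ≥ k is Kopylov's method. Add edges until G is edge-maximal P_k-free. If each
vertex of A has at least α neighbours in A, each vertex of B at least β in B, and k ≤ α + β + 1,
then A and B are completely joined (`adj_of_card_neighbors`). Comparison with a maximum clique
yields p ≥ 1 with 2p + 2 ≤ k such that every set of more than k - 1 - p vertices contains a vertex
with at most p neighbours in the set (`exists_degenerate`). Deleting such vertices bounds the count
by C(k-1-p,t) + (n-(k-1-p)) C(p,t-1), which is below f(n) for t ≥ 3 (`peeling_bound_lt`). -/

/-! ### Binomial inequalities and the extremal function -/

theorem choose_add_ge (p c t : ℕ) :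
    c.choose (t + 2) + p * c.choose (t + 1) + p.choose 2 * c.choose t ≤ (p + c).choose (t + 2) := by
  rw [Nat.add_choose_eq]
  have hsub : ({(0, t + 2), (1, t + 1), (2, t)} : Finset (ℕ × ℕ)) ⊆
      Finset.HasAntidiagonal.antidiagonal (t + 2) := by
    intro x hx
    simp only [Finset.mem_insert, Finset.mem_singleton] at hx
    rw [Finset.HasAntidiagonal.mem_antidiagonal]
    rcases hx with rfl | rfl | rfl <;> simp only [] <;> omega
  refine le_trans (le_of_eq ?_) (Finset.sum_le_sum_of_subset hsub)
  rw [Finset.sum_insert (by simp), Finset.sum_insert (by simp), Finset.sum_singleton]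
  simp only [Nat.choose_zero_right, Nat.choose_one_right]
  ring

theorem choose_lt_choose_left {x y j : ℕ} (hxy : x < y) (hj : 1 ≤ j) (hjy : j ≤ y) :
    x.choose j < y.choose j := by
  obtain ⟨z, rfl⟩ : ∃ z, y = z + 1 := ⟨y - 1, by omega⟩
  obtain ⟨i, rfl⟩ : ∃ i, j = i + 1 := ⟨j - 1, by omega⟩
  have h1 := Nat.choose_le_choose (i + 1) (show x ≤ z by omega)
  have h2 : 0 < z.choose i := Nat.choose_pos (by omega)
  rw [Nat.choose_succ_succ']
  omega

/-- The increments C(x,t) of x ↦ C(x,t+1) are nondecreasing in x. -/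
theorem choose_convex {d a : ℕ} (hda : d ≤ a) (e t : ℕ) :
    a.choose (t + 1) + (d + e).choose (t + 1) ≤ (a + e).choose (t + 1) + d.choose (t + 1) := by
  induction e with
  | zero => simp
  | succ e ih =>
    rw [← add_assoc, ← add_assoc, Nat.choose_succ_succ', Nat.choose_succ_succ' (a + e)]
    have := Nat.choose_le_choose t (show d + e ≤ a + e by omega)
    omega

theorem choose_convex_strict {d a : ℕ} (hda : d < a) {e t : ℕ} (he : 0 < e) (ht : 1 ≤ t)
    (hte : t + 1 ≤ a + e) :
    a.choose (t + 1) + (d + e).choose (t + 1) < (a + e).choose (t + 1) + d.choose (t + 1) := by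
  obtain ⟨e, rfl⟩ : ∃ f, e = f + 1 := ⟨e - 1, by omega⟩
  have h := choose_convex hda.le e t
  rw [← add_assoc, ← add_assoc, Nat.choose_succ_succ', Nat.choose_succ_succ' (a + e)]
  have := choose_lt_choose_left (show d + e < a + e by omega) ht (by omega)
  omega

theorem succ_mul_choose_succ_eq (p u : ℕ) :
    (u + 1) * p.choose (u + 1) = (p - u) * p.choose u := by
  have := Nat.choose_succ_right_eq p u
  linarith [mul_comm (p - u) (p.choose u), mul_comm (u + 1) (p.choose (u + 1))]

theorem succ_mul_choose_succ_le (p u : ℕ) :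
    (u + 1) * p.choose (u + 1) ≤ p * p.choose u := by
  rw [succ_mul_choose_succ_eq]
  exact Nat.mul_le_mul_right _ (Nat.sub_le _ _)

/-- Vandermonde for C(2p,u+2) gives (u+3) C(p,u+2) ≤ C(k-2,u+2); absorption trades the factor u+3
for k-1. Thus one K_{k-1} pays for k-1 peeled vertices. -/
theorem mul_choose_le_choose_succ {p k u : ℕ} (hk : 2 * p + 2 ≤ k) :
    (k - 1) * p.choose (u + 2) ≤ (k - 1).choose (u + 3) := by
  obtain ⟨m, rfl⟩ : ∃ m, k = m + 2 := ⟨k - 2, by omega⟩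
  have h1 : (u + 3) * p.choose (u + 2) ≤ m.choose (u + 2) := by
    have h2 := choose_add_ge p p u
    have h3 := succ_mul_choose_succ_le p (u + 1)
    have h4 := Nat.choose_le_choose (u + 2) (show p + p ≤ m by omega)
    nlinarith
  have h5 := Nat.add_one_mul_choose_eq m (u + 2)
  have h6 : (u + 3) * ((m + 1) * p.choose (u + 2)) ≤ (u + 3) * (m + 1).choose (u + 3) := by
    nlinarith
  exact Nat.le_of_mul_le_mul_left h6 (by omega)

/-- Once r ≥ p, each further vertex raises C(r,t+1) by C(r,t) ≥ C(p,t). -/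
theorem mul_choose_le_add (r p t : ℕ) :
    r * p.choose t ≤ p * p.choose t + r.choose (t + 1) := by
  induction r with
  | zero => simp
  | succ r ih =>
    rcases le_or_gt (r + 1) p with h | h
    · exact le_add_right (Nat.mul_le_mul_right _ h)
    · have := Nat.choose_le_choose t (show p ≤ r by omega)
      rw [Nat.choose_succ_succ', add_mul, one_mul]
      omega

theorem choose_add_two_mul_lt {p c u : ℕ} (hp : 1 ≤ p) (hc : p < c) (hu : u + 3 ≤ p + c) :
    c.choose (u + 3) + 2 * p * p.choose (u + 2) < (p + c).choose (u + 3) := by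
  have h1 := choose_add_ge p c (u + 1)
  rcases le_or_gt (u + 2) c with h | h
  · have h2 := choose_lt_choose_left hc (show 1 ≤ u + 2 by omega) h
    have h3 : p * p.choose (u + 2) < p * c.choose (u + 2) := Nat.mul_lt_mul_of_pos_left h2 hp
    have h4 : p * p.choose (u + 2) ≤ p.choose 2 * c.choose (u + 1) := by
      refine le_trans ?_ (Nat.mul_le_mul_left _ (Nat.choose_le_choose (u + 1) hc.le))
      have h5 := succ_mul_choose_succ_eq p (u + 1)
      have h6 : 2 * p.choose 2 = p * (p - 1) := by
        have := succ_mul_choose_succ_eq p 1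
        simp only [Nat.choose_one_right] at this
        linarith [mul_comm (p - 1) p]
      have h7 : (p - (u + 1)) * p.choose (u + 1) ≤ (p - 1) * p.choose (u + 1) :=
        Nat.mul_le_mul_right _ (by omega)
      -- Here t = u + 3 ≥ 3 matters: the factor u + 2 in `h5` is at least 2.
      have h8 : 2 * p.choose (u + 2) ≤ (p - 1) * p.choose (u + 1) := by nlinarith
      have h9 : 2 * (p * p.choose (u + 2)) ≤ 2 * (p.choose 2 * p.choose (u + 1)) := by
        calc 2 * (p * p.choose (u + 2)) = p * (2 * p.choose (u + 2)) := by ring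
          _ ≤ p * ((p - 1) * p.choose (u + 1)) := Nat.mul_le_mul_left _ h8
          _ = (2 * p.choose 2) * p.choose (u + 1) := by rw [h6]; ring
          _ = _ := by ring
      omega
    have h10 : 2 * p * p.choose (u + 2) = p * p.choose (u + 2) + p * p.choose (u + 2) := by ring
    simp only [show u + 1 + 2 = u + 3 from rfl, show u + 1 + 1 = u + 2 from rfl] at h1
    omega
  · rw [Nat.choose_eq_zero_of_lt (show c < u + 3 by omega),
      Nat.choose_eq_zero_of_lt (show p < u + 2 by omega)]
    simpa using Nat.choose_pos hu

/-- The number of `t`-cliques of the disjoint union of cliques of order `K` and a smaller clique,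
with `n` vertices in total. -/
def cliqueBound (t K n : ℕ) : ℕ := n / K * K.choose t + (n % K).choose t

theorem cliqueBound_eq {t K q r : ℕ} (hr : r < K) :
    cliqueBound t K (q * K + r) = q * K.choose t + r.choose t := by
  have hK : 0 < K := by omega
  rw [cliqueBound, mul_comm q K, Nat.mul_add_mod, Nat.mod_eq_of_lt hr, Nat.mul_add_div hK,
    Nat.div_eq_of_lt hr, add_zero]

theorem cliqueBound_of_lt {t K n : ℕ} (h : n < K) : cliqueBound t K n = n.choose t := by
  simpa using cliqueBound_eq (t := t) (q := 0) h

theorem cliqueBound_self {t K : ℕ} (ht : 0 < t) (h : 0 < K) :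
    cliqueBound t K K = K.choose t := by
  simpa [Nat.choose_eq_zero_of_lt ht] using cliqueBound_eq (t := t) (q := 1) h

theorem cliqueBound_add {t K a b : ℕ} (ht : 1 ≤ t) (hK : 0 < K) :
    cliqueBound t K a + cliqueBound t K b ≤ cliqueBound t K (a + b) := by
  obtain ⟨t, rfl⟩ : ∃ f, t = f + 1 := ⟨t - 1, by omega⟩
  have ha := Nat.div_add_mod' a K
  have hb := Nat.div_add_mod' b K
  have ha' := Nat.mod_lt a hK
  have hb' := Nat.mod_lt b hK
  generalize a / K = q₁ at *
  generalize b / K = q₂ at *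
  generalize a % K = r₁ at *
  generalize b % K = r₂ at *
  subst ha hb
  rw [cliqueBound_eq ha', cliqueBound_eq hb']
  rcases lt_or_ge (r₁ + r₂) K with h | h
  · rw [show q₁ * K + r₁ + (q₂ * K + r₂) = (q₁ + q₂) * K + (r₁ + r₂) by ring, cliqueBound_eq h]
    have := choose_convex (Nat.zero_le r₁) r₂ t
    simp only [zero_add, Nat.choose_zero_succ] at this
    nlinarith
  -- The remainders overflow; convexity replaces r₁, r₂ by K, d, which have the same sum.
  · obtain ⟨d, hd⟩ := Nat.exists_eq_add_of_le h
    rw [show q₁ * K + r₁ + (q₂ * K + r₂) = (q₁ + q₂ + 1) * K + d by linarith,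
      cliqueBound_eq (by omega)]
    have := choose_convex (show d ≤ r₁ by omega) (K - r₁) t
    rw [show d + (K - r₁) = r₂ by omega, show r₁ + (K - r₁) = K by omega] at this
    nlinarith

theorem cliqueBound_add_strict {t K a b : ℕ} (ht : 2 ≤ t) (htK : t ≤ K) (ha : a < K) (hb : b < K)
    (hab : K ≤ a + b) :
    cliqueBound t K a + cliqueBound t K b < cliqueBound t K (a + b) := by
  obtain ⟨t, rfl⟩ : ∃ f, t = f + 1 := ⟨t - 1, by omega⟩
  obtain ⟨d, hd⟩ := Nat.exists_eq_add_of_le hab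
  rw [cliqueBound_of_lt ha, cliqueBound_of_lt hb, show a + b = 1 * K + d by omega,
    cliqueBound_eq (by omega)]
  have := choose_convex_strict (show d < a by omega) (show 0 < K - a by omega) (t := t)
    (by omega) (by omega)
  rw [show d + (K - a) = b by omega, show a + (K - a) = K by omega] at this
  omega

theorem peeling_bound_lt {t k p m : ℕ} (ht : 3 ≤ t) (htk : t < k) (hp : 1 ≤ p)
    (hpk : 2 * p + 2 ≤ k) (hm : k ≤ m) :
    (k - 1 - p).choose t + (m - (k - 1 - p)) * p.choose (t - 1) < cliqueBound t (k - 1) m := by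
  obtain ⟨u, rfl⟩ : ∃ u, t = u + 3 := ⟨t - 3, by omega⟩
  rw [show u + 3 - 1 = u + 2 from rfl]
  have hr := Nat.mod_lt m (show 0 < k - 1 by omega)
  have hd := Nat.div_add_mod' m (k - 1)
  have hq : 1 ≤ m / (k - 1) := (Nat.one_le_div_iff (by omega)).2 (by omega)
  rw [cliqueBound]
  generalize m / (k - 1) = q at *
  generalize m % (k - 1) = r at *
  obtain ⟨q, rfl⟩ : ∃ f, q = f + 1 := ⟨q - 1, by omega⟩
  -- The q blocks are paid for by `h1` and the r vertices by `h2`, up to p · C(p,u+2); this excess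
  -- and the last p vertices make the 2p of `h3`.
  have hm' : m - (k - 1 - p) = q * (k - 1) + r + p := by
    have : (q + 1) * (k - 1) = q * (k - 1) + (k - 1) := by ring
    omega
  have h1 := mul_choose_le_choose_succ (u := u) hpk
  have h2 := mul_choose_le_add r p (u + 2)
  have h3 := choose_add_two_mul_lt hp (show p < k - 1 - p by omega) (u := u) (by omega)
  rw [show p + (k - 1 - p) = k - 1 by omega] at h3
  rw [hm']
  have h4 := Nat.mul_le_mul_left q h1
  nlinarith

/-! ### Paths as duplicate-free lists, and surgery on them -/

section Lists

variable {V : Type*}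

theorem pathFree_iff_forall_isChain {k : ℕ} {G : SimpleGraph V} :
    PathFree k G ↔ ∀ l : List V, l.IsChain G.Adj → l.Nodup → l.length < k := by
  constructor
  · intro h l hc hn
    by_contra! hk
    refine h ⟨⟨⟨fun i => l[i.1], ?_⟩, ?_⟩⟩
    · intro a b hab
      have hc' := List.isChain_iff_getElem.1 hc
      rcases pathGraph_adj.1 hab with h1 | h1
      · have := hc' a.1 (by omega)
        simpa only [h1] using this
      · have := hc' b.1 (by omega)
        simpa only [h1] using this.symm
    · intro a b hab
      exact Fin.ext ((List.Nodup.getElem_inj_iff hn).1 hab)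
  · rintro h ⟨⟨f, hf⟩⟩
    have := h (List.ofFn f) ?_ ?_
    · simp at this
    · rw [List.isChain_iff_getElem]
      intro i hi
      simp only [List.getElem_ofFn]
      apply f.map_adj
      rw [pathGraph_adj]
      simp
    · rw [List.nodup_ofFn]
      exact hf

/-- If y is at position at least |N|, the initial segment serves. Otherwise some w ∈ N lies that far
out, beyond y: start just after y, run to w, jump to u, and run to y. -/
theorem exists_isChain_suffix_prefix {G : SimpleGraph V} {l : List V} {u y : V} {N : Finset V}
    (hc : l.IsChain G.Adj) (hn : l.Nodup) (hu : l.head? = some u)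
    (hN : ∀ w ∈ N, G.Adj u w ∧ w ∈ l) (hy : y ∈ l) :
    ∃ l' : List V, (l' ++ [y]).IsChain G.Adj ∧ (l' ++ [y]).Nodup ∧ (∀ z ∈ l', z ∈ l) ∧
      N.card ≤ l'.length := by
  classical
  obtain ⟨s, t, rfl⟩ := List.append_of_mem hy
  by_cases hs : N.card ≤ s.length
  · refine ⟨s, ?_, ?_, ?_, hs⟩
    · exact (List.isChain_split.1 hc).1
    · rw [List.append_cons] at hn
      exact hn.of_append_left
    · simp +contextual
  · -- some neighbour of `u` lies far enough in `t`
    obtain ⟨w, hwN, hw⟩ : ∃ w ∈ N, N.card ≤ (s ++ y :: t).idxOf w := by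
      by_contra! hcon
      -- Position 0 is u itself, so |N| distinct positions would fit into |N| - 1 places.
      have hsub : N.image (fun w => (s ++ y :: t).idxOf w) ⊆ Finset.Ico 1 N.card := by
        intro i hi
        obtain ⟨w, hw, rfl⟩ := Finset.mem_image.1 hi
        rw [Finset.mem_Ico]
        refine ⟨?_, hcon w hw⟩
        rw [Nat.one_le_iff_ne_zero]
        intro h0
        have h1 := List.idxOf_lt_length_of_mem (hN w hw).2
        have h2 : (s ++ y :: t)[(s ++ y :: t).idxOf w] = w := List.getElem_idxOf h1
        rw [List.head?_eq_getElem?, List.getElem?_eq_getElem (by omega)] at hu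
        simp only [h0] at h2
        rw [h2] at hu
        simp only [Option.some.injEq] at hu
        exact G.irrefl (hu ▸ (hN w hw).1)
      have hcard := Finset.card_le_card hsub
      rw [Finset.card_image_of_injOn, Nat.card_Ico] at hcard
      · have : 0 < N.card := by omega
        omega
      · intro a ha b hb hab
        exact (List.idxOf_inj (hN a ha).2).1 hab
    obtain ⟨hadj, hwl⟩ := hN w hwN
    have hwt : w ∈ t := by
      by_contra hwt
      have : (s ++ y :: t).idxOf w < (s ++ [y]).length := by
        have hw' : w ∈ s ++ [y] := by
          simp only [List.mem_append, List.mem_cons, List.not_mem_nil] at hwl ⊢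
          tauto
        rw [List.append_cons, List.idxOf_append_of_mem hw']
        exact List.idxOf_lt_length_of_mem hw'
      simp at this
      omega
    obtain ⟨a, b, rfl⟩ := List.append_of_mem hwt
    have hidx : (s ++ y :: (a ++ w :: b)).idxOf w ≤ s.length + 1 + a.length := by
      rw [show s ++ y :: (a ++ w :: b) = (s ++ y :: a) ++ w :: b by simp]
      have hw' : w ∉ s ++ y :: a := by
        intro hmem
        rw [show s ++ y :: (a ++ w :: b) = (s ++ y :: a) ++ w :: b by simp] at hn
        exact (List.disjoint_of_nodup_append hn) hmem (by simp)
      rw [List.idxOf_append_of_notMem hw']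
      simp
      omega
    refine ⟨a ++ [w] ++ s, ?_, ?_, ?_, ?_⟩
    · rw [List.append_assoc, List.isChain_append]
      rw [List.isChain_split, ← List.cons_append] at hc
      refine ⟨?_, hc.1, ?_⟩
      · exact ((List.isChain_split.1 hc.2).1).tail
      · intro x hx z hz
        have hx' : x = w := by simpa [eq_comm] using hx
        have hz' : z = u := by
          cases s <;> simp_all
        rw [hx', hz']
        exact hadj.symm
    · have : (s ++ y :: (a ++ w :: b)).Perm ((a ++ [w] ++ s ++ [y]) ++ b) := by
        rw [List.perm_iff_count]
        intro x
        simp only [List.count_append, List.count_cons, List.count_nil]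
        omega
      exact ((this.nodup_iff).1 hn).of_append_left
    · intro z
      simp only [List.mem_append, List.mem_cons, List.not_mem_nil]
      tauto
    · simp
      omega

/-- A shortest walk from S to T is a path meeting each set only at its end. -/
theorem exists_isChain_connecting {G : SimpleGraph V} (hG : G.Preconnected) {S T : Set V}
    (hS : S.Nonempty) (hT : T.Nonempty) (hST : Disjoint S T) :
    ∃ y ∈ S, ∃ w ∈ T, ∃ l : List V, (y :: (l ++ [w])).IsChain G.Adj ∧ (y :: (l ++ [w])).Nodup ∧
      ∀ z ∈ l, z ∉ S ∧ z ∉ T := by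
  classical
  have hex : ∃ n, ∃ y ∈ S, ∃ w ∈ T, ∃ p : G.Walk y w, p.length = n := by
    obtain ⟨y, hy⟩ := hS
    obtain ⟨w, hw⟩ := hT
    obtain ⟨p⟩ := hG y w
    exact ⟨_, y, hy, w, hw, p, rfl⟩
  obtain ⟨y, hy, w, hw, p, hp⟩ := Nat.find_spec hex
  have hmin : ∀ y' ∈ S, ∀ w' ∈ T, ∀ p' : G.Walk y' w', p.length ≤ p'.length := by
    intro y' hy' w' hw' p'
    rw [hp]
    exact Nat.find_min' hex ⟨y', hy', w', hw', p', rfl⟩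
  have hyw : y ≠ w := fun h => Set.disjoint_left.1 hST hy (h ▸ hw)
  have hpath : p.support.Nodup := by
    have h1 : p.bypass = p :=
      p.bypass_eq_self_of_length_le_length_bypass (hmin y hy w hw _)
    exact h1 ▸ p.bypass_isPath.support_nodup
  have hchain : p.support.IsChain G.Adj := p.isChain_adj_support
  have hSy : ∀ z ∈ p.support, z ∈ S → z = y := by
    intro z hz hzS
    by_contra hne
    have h1 := hmin z hzS w hw (p.dropUntil z hz)
    have h2 := congrArg Walk.length (p.take_spec hz)
    rw [Walk.length_append] at h2
    have h3 : (p.takeUntil z hz).length ≠ 0 := fun h0 => hne (Walk.eq_of_length_eq_zero h0).symm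
    omega
  have hTw : ∀ z ∈ p.support, z ∈ T → z = w := by
    intro z hz hzT
    by_contra hne
    have h1 := hmin y hy z hzT (p.takeUntil z hz)
    have h2 := congrArg Walk.length (p.take_spec hz)
    rw [Walk.length_append] at h2
    have h3 : (p.dropUntil z hz).length ≠ 0 := fun h0 => hne (Walk.eq_of_length_eq_zero h0)
    omega
  obtain ⟨l, hl⟩ : ∃ l, p.support = y :: (l ++ [w]) := by
    have h1 : p.support = y :: p.support.tail := p.cons_tail_support.symm
    have h2 : p.support.tail ≠ [] := by
      intro h0
      rw [h0] at h1
      have := p.end_mem_support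
      rw [h1] at this
      exact hyw (by simpa [eq_comm] using this)
    refine ⟨p.support.tail.dropLast, ?_⟩
    rw [h1]
    congr 1
    have h3 := List.dropLast_append_getLast h2
    rw [List.tail_cons]
    conv_lhs => rw [← h3]
    congr 2
    rw [List.getLast_tail, p.getLast_support]
  rw [hl] at hpath hchain hSy hTw
  refine ⟨y, hy, w, hw, l, hchain, hpath, fun z hz => ⟨fun h => ?_, fun h => ?_⟩⟩
  · have := hSy z (by simp [hz]) h
    subst this
    simp_all
  · have := hTw z (by simp [hz]) h
    subst this
    rw [List.nodup_cons, List.nodup_append'] at hpath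
    exact hpath.2.2.2 hz (by simp)

end Lists

/-! ### The cone, and crossing neighbours on a path -/

section Cone

variable {V : Type*}

/-- The graph obtained from `G` by adding a vertex adjacent to all other vertices. -/
def coneGraph (G : SimpleGraph V) : SimpleGraph (Option V) where
  Adj x y := x ≠ y ∧ ∀ a b, x = some a → y = some b → G.Adj a b
  symm := ⟨fun _ _ h => ⟨h.1.symm, fun a b ha hb => (h.2 b a hb ha).symm⟩⟩
  loopless := ⟨fun _ h => h.1 rfl⟩

theorem coneGraph_adj_some {G : SimpleGraph V} {a b : V} :
    (coneGraph G).Adj (some a) (some b) ↔ G.Adj a b := by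
  constructor
  · intro h
    exact h.2 a b rfl rfl
  · intro h
    refine ⟨by simpa using h.ne, fun a' b' ha hb => ?_⟩
    cases ha
    cases hb
    exact h

theorem coneGraph_adj_none {G : SimpleGraph V} {x : Option V} :
    (coneGraph G).Adj none x ↔ x ≠ none := by
  constructor
  · intro h
    exact h.1.symm
  · intro h
    exact ⟨h.symm, fun a b ha => by simp at ha⟩

theorem exists_eq_map_some {l : List (Option V)} (h : none ∉ l) : ∃ l' : List V, l = l'.map some := by
  refine ⟨l.reduceOption, ?_⟩
  induction l with
  | nil => rfl
  | cons x l ih =>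
    cases x with
    | none => simp at h
    | some a =>
      rw [List.reduceOption_cons_of_some, List.map_cons, ← ih fun h' => h (List.mem_cons_of_mem _ h')]

theorem isChain_coneGraph_map_some {G : SimpleGraph V} {l : List V} :
    (l.map some).IsChain (coneGraph G).Adj ↔ l.IsChain G.Adj := by
  rw [List.isChain_map]
  simp only [coneGraph_adj_some]

theorem isChain_reverse_adj {W : Type*} {G : SimpleGraph W} {l : List W} :
    l.reverse.IsChain G.Adj ↔ l.IsChain G.Adj := by
  rw [List.isChain_reverse]
  simp only [G.adj_comm]

/-- In the cone over a `P_k`-free graph, cycles have at most `k` vertices. -/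
theorem length_le_of_closed_isChain_coneGraph {k : ℕ} {G : SimpleGraph V} (hG : PathFree k G)
    {l : List (Option V)} (hc : l.IsChain (coneGraph G).Adj) (hn : l.Nodup)
    (hcl : ∀ x ∈ l.getLast?, ∀ y ∈ l.head?, (coneGraph G).Adj x y) : l.length ≤ k := by
  rw [pathFree_iff_forall_isChain] at hG
  have key : ∀ m : List (Option V), none ∉ m → m.IsChain (coneGraph G).Adj → m.Nodup →
      m.length < k := by
    intro m hm hc hn
    obtain ⟨m', rfl⟩ := exists_eq_map_some hm
    rw [isChain_coneGraph_map_some] at hc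
    simpa using hG m' hc hn.of_map
  by_cases h : none ∈ l
  · obtain ⟨s, t, rfl⟩ := List.append_of_mem h
    have h1 := key (t ++ s) ?_ ?_ ?_
    · simp at h1 ⊢
      omega
    · have := List.nodup_middle.1 hn
      rw [List.nodup_cons] at this
      simp only [List.mem_append] at this ⊢
      tauto
    · have hs := hc.left_of_append
      have ht := hc.right_of_append.tail
      rw [List.tail_cons] at ht
      rw [List.isChain_append]
      refine ⟨ht, hs, fun x hx y hy => hcl x ?_ y ?_⟩
      · cases t <;> simp_all
      · cases s <;> simp_all
    · have := List.nodup_middle.1 hn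
      rw [List.nodup_cons] at this
      exact (List.perm_append_comm.nodup_iff).1 this.2
  · exact (key l h hc hn).le

/-- If the neighbours of the two ends of a path cross, there is a cycle at least as long as
both the path and the degree sum of the ends (both degrees taken within the path). -/
theorem idxOf_le_idxOf_of_no_long_cycle {W : Type*} [BEq W] [LawfulBEq W] {G : SimpleGraph W}
    {L : ℕ}
    (hno : ∀ l : List W, l.IsChain G.Adj → l.Nodup →
      (∀ x ∈ l.getLast?, ∀ y ∈ l.head?, G.Adj x y) → l.length < L)
    {l : List W} (hc : l.IsChain G.Adj) (hn : l.Nodup) (hl : L ≤ l.length) {u v : W}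
    (hu : l.head? = some u) (hv : l.getLast? = some v) {X Y : Finset W}
    (hX : ∀ x ∈ X, G.Adj u x ∧ x ∈ l) (hY : ∀ y ∈ Y, G.Adj v y ∧ y ∈ l)
    (hXY : L ≤ X.card + Y.card) {x y : W} (hx : x ∈ X) (hy : y ∈ Y) : l.idxOf x ≤ l.idxOf y := by
  by_contra! hlt
  -- Among crossing pairs take one of least gap. The cycle u … y v … x u misses only the vertices
  -- strictly between y and x.
  have hex : ∃ d, ∃ x ∈ X, ∃ y ∈ Y, l.idxOf x = l.idxOf y + 1 + d :=
    ⟨l.idxOf x - l.idxOf y - 1, x, hx, y, hy, by omega⟩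
  clear hx hy hlt x y
  obtain ⟨x, hx, y, hy, hd⟩ := Nat.find_spec hex
  have hmin : ∀ x' ∈ X, ∀ y' ∈ Y, l.idxOf y' < l.idxOf x' →
      l.idxOf x + l.idxOf y' ≤ l.idxOf x' + l.idxOf y := by
    intro x' hx' y' hy' hlt
    have := Nat.find_min' hex ⟨x', hx', y', hy', show _ = _ + 1 + (l.idxOf x' - l.idxOf y' - 1) by
      omega⟩
    omega
  have hlx := List.idxOf_lt_length_of_mem (hX x hx).2
  have hly := List.idxOf_lt_length_of_mem (hY y hy).2
  have hgx : l[l.idxOf x] = x := List.getElem_idxOf hlx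
  have hgy : l[l.idxOf y] = y := List.getElem_idxOf hly
  -- the cycle
  have hcyc := hno (l.take (l.idxOf y + 1) ++ (l.drop (l.idxOf x)).reverse) ?_ ?_ ?_
  · rw [List.length_append, List.length_take, List.length_reverse, List.length_drop] at hcyc
    -- counting
    have hpos : ∀ x' ∈ X, 1 ≤ l.idxOf x' := by
      intro x' hx'
      rw [Nat.one_le_iff_ne_zero]
      intro h0
      have h1 := List.idxOf_lt_length_of_mem (hX x' hx').2
      have h2 : l[l.idxOf x'] = x' := List.getElem_idxOf h1
      rw [List.head?_eq_getElem?, List.getElem?_eq_getElem (by omega)] at hu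
      simp only [h0] at h2
      rw [h2] at hu
      simp only [Option.some.injEq] at hu
      exact G.irrefl (hu ▸ (hX x' hx').1)
    have hend : ∀ y' ∈ Y, l.idxOf y' + 1 < l.length := by
      intro y' hy'
      have h1 := List.idxOf_lt_length_of_mem (hY y' hy').2
      have h2 : l[l.idxOf y'] = y' := List.getElem_idxOf h1
      by_contra hcon
      have h3 : l.idxOf y' = l.length - 1 := by omega
      rw [List.getLast?_eq_getElem?, List.getElem?_eq_getElem (by omega)] at hv
      simp only [h3] at h2
      rw [h2] at hv
      simp only [Option.some.injEq] at hv
      exact G.irrefl (hv ▸ (hY y' hy').1)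
    have hlen : ∀ x' ∈ X, l.idxOf x' < l.length := fun x' hx' =>
      List.idxOf_lt_length_of_mem (hX x' hx').2
    have hXc : (X.image (fun a => l.idxOf a - 1)).card = X.card := by
      apply Finset.card_image_of_injOn
      intro a ha b hb hab
      have h1 := hpos a ha
      have h2 := hpos b hb
      simp only at hab
      exact (List.idxOf_inj (hX a ha).2).1 (by omega)
    have hYc : (Y.image (fun a => l.idxOf a)).card = Y.card := by
      apply Finset.card_image_of_injOn
      intro a ha b hb hab
      exact (List.idxOf_inj (hY a ha).2).1 hab
    -- With gap zero the cycle contains the whole path.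
    rcases Nat.eq_zero_or_pos (Nat.find hex) with h0 | h0
    · omega
    -- A common value would be a crossing pair of gap zero.
    have hdisj : Disjoint (X.image (fun a => l.idxOf a - 1)) (Y.image (fun a => l.idxOf a)) := by
      rw [Finset.disjoint_left]
      intro i hi hi'
      obtain ⟨a, ha, rfl⟩ := Finset.mem_image.1 hi
      obtain ⟨b, hb, hab⟩ := Finset.mem_image.1 hi'
      have h1 := hpos a ha
      have h2 := hmin a ha b hb (by omega)
      omega
    -- By minimality neither set has a position inside the gap; the right side has at most as many
    -- elements as the cycle has vertices.
    have hsub : X.image (fun a => l.idxOf a - 1) ∪ Y.image (fun a => l.idxOf a) ⊆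
        Finset.range (l.idxOf y + 1) ∪ Finset.Ico (l.idxOf x - 1) (l.length - 1) := by
      intro i hi
      rw [Finset.mem_union, Finset.mem_range, Finset.mem_Ico]
      rcases Finset.mem_union.1 hi with hi | hi
      · obtain ⟨a, ha, rfl⟩ := Finset.mem_image.1 hi
        have h1 := hmin a ha y hy
        have h2 := hlen a ha
        have h3 := hpos a ha
        by_cases h4 : l.idxOf y < l.idxOf a
        · have := h1 h4
          omega
        · omega
      · obtain ⟨b, hb, rfl⟩ := Finset.mem_image.1 hi
        have h1 := hmin x hx b hb
        have h2 := hend b hb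
        by_cases h4 : l.idxOf b < l.idxOf x
        · have := h1 h4
          omega
        · omega
    have h1 := Finset.card_le_card hsub
    rw [Finset.card_union_of_disjoint hdisj, hXc, hYc] at h1
    have h2 := Finset.card_union_le (Finset.range (l.idxOf y + 1))
      (Finset.Ico (l.idxOf x - 1) (l.length - 1))
    rw [Finset.card_range, Nat.card_Ico] at h2
    omega
  · rw [List.isChain_append, isChain_reverse_adj]
    refine ⟨hc.take _, hc.drop _, fun a ha b hb => ?_⟩
    have ha' : a = y := by
      rw [List.getLast?_eq_getElem?, List.length_take, List.getElem?_take_of_lt (by omega),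
        show min (l.idxOf y + 1) l.length - 1 = l.idxOf y by omega,
        List.getElem?_eq_getElem hly, hgy] at ha
      simpa [eq_comm] using ha
    have hb' : b = v := by
      rw [List.head?_reverse, List.getLast?_drop, if_neg (by omega), hv] at hb
      simpa [eq_comm] using hb
    rw [ha', hb']
    exact (hY y hy).1.symm
  · rw [List.nodup_append', List.nodup_reverse]
    refine ⟨hn.sublist (List.take_sublist _ _), hn.sublist (List.drop_sublist _ _), ?_⟩
    rw [List.disjoint_reverse_right]
    exact List.disjoint_take_drop hn (by omega)
  · intro a ha b hb
    have hb' : b = u := by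
      have : l ≠ [] := by rintro rfl; simp at hu
      cases l with
      | nil => simp at hu
      | cons c l => simp_all
    have ha' : a = x := by
      rw [List.getLast?_append, List.getLast?_reverse, List.head?_drop,
        List.getElem?_eq_getElem hlx, hgx] at ha
      simpa [eq_comm] using ha
    rw [ha', hb']
    exact (hX x hx).1.symm

end Cone

/-! ### Kopylov's lemma -/

section Kopylov

variable {V : Type*}

/-- In an edge-maximal `P_k`-free graph, non-adjacent vertices are joined by a path with at least
`k + 1` vertices in the cone. -/
theorem exists_isChain_coneGraph_of_not_adj {k : ℕ} {G : SimpleGraph V} (hG : PathFree k G)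
    {a b : V} (hab : a ≠ b) (hmax : ¬ PathFree k (G ⊔ edge a b)) :
    ∃ l : List (Option V), l.IsChain (coneGraph G).Adj ∧ l.Nodup ∧ k + 1 ≤ l.length ∧
      l.head? = some (some a) ∧ l.getLast? = some (some b) := by
  rw [pathFree_iff_forall_isChain] at hmax hG
  push Not at hmax
  obtain ⟨l, hc, hn, hk⟩ := hmax
  have hnc : ¬ l.IsChain G.Adj := fun h => absurd (hG l h hn) (by omega)
  rw [List.isChain_iff_forall_rel_of_append_cons_cons] at hnc
  push Not at hnc
  obtain ⟨x, y, s, t, rfl, hxy⟩ := hnc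
  have hsplit := List.isChain_append_cons_cons.1 hc
  have hpair : (x = a ∧ y = b) ∨ (x = b ∧ y = a) := by
    have := hsplit.2.1
    rw [sup_adj, edge_adj] at this
    tauto
  have hn' := hn
  rw [List.nodup_append'] at hn'
  have hlift : ∀ m : List V, (x ∉ m ∨ y ∉ m) → m.IsChain (G ⊔ edge a b).Adj →
      m.IsChain G.Adj := by
    intro m hm hmc
    refine List.IsChain.imp_of_mem_imp ?_ hmc
    intro u v hu hv huv
    rw [sup_adj, edge_adj] at huv
    rcases huv with huv | ⟨huv, -⟩
    · exact huv
    · exfalso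
      rcases hpair with ⟨rfl, rfl⟩ | ⟨rfl, rfl⟩ <;> rcases huv with ⟨rfl, rfl⟩ | ⟨rfl, rfl⟩ <;> tauto
  have h1 : (s ++ [x]).IsChain G.Adj := by
    refine hlift _ (Or.inr ?_) hsplit.1
    intro hy
    rw [List.append_cons] at hn
    exact List.disjoint_of_nodup_append hn hy (by simp)
  have h2 : (y :: t).IsChain G.Adj := by
    refine hlift _ (Or.inl ?_) hsplit.2.2
    have := hn'.2.1
    rw [List.nodup_cons] at this
    exact this.1
  -- From x run back to the start of the path, pass through the apex to its other end, and run back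
  -- to y; the new edge xy is not used.
  have key : ((s ++ [x]).reverse.map some ++ none :: (y :: t).reverse.map some).IsChain
      (coneGraph G).Adj := by
    rw [List.isChain_append]
    refine ⟨?_, ?_, ?_⟩
    · rw [isChain_coneGraph_map_some, isChain_reverse_adj]
      exact h1
    · rw [List.isChain_cons]
      refine ⟨?_, ?_⟩
      · intro z hz
        rw [coneGraph_adj_none]
        rintro rfl
        have := List.mem_of_mem_head? hz
        simp at this
      · rw [isChain_coneGraph_map_some, isChain_reverse_adj]
        exact h2
    · intro u hu v hv
      have hv' : v = none := by simpa [eq_comm] using hv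
      rw [hv']
      refine ((coneGraph_adj_none (G := G)).2 ?_).symm
      rintro rfl
      have := List.mem_of_mem_getLast? hu
      simp at this
  have keyn : ((s ++ [x]).reverse.map some ++ none :: (y :: t).reverse.map some).Nodup := by
    rw [List.nodup_middle, List.nodup_cons, ← List.map_append,
      List.nodup_map_iff (Option.some_injective V)]
    refine ⟨by simp, ?_⟩
    rw [List.append_cons] at hn
    refine List.Perm.nodup ?_ hn
    exact (List.reverse_perm _).symm.append (List.reverse_perm _).symm
  have keyl : k + 1 ≤
      ((s ++ [x]).reverse.map some ++ none :: (y :: t).reverse.map some).length := by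
    simp at hk ⊢
    omega
  rcases hpair with ⟨rfl, rfl⟩ | ⟨rfl, rfl⟩
  · exact ⟨_, key, keyn, keyl, by simp, by simp [List.getLast?_cons]⟩
  · refine ⟨((s ++ [x]).reverse.map some ++ none :: (y :: t).reverse.map some).reverse, ?_, ?_, ?_,
      by simp, by simp [List.getLast?_cons]⟩
    · rwa [isChain_reverse_adj]
    · rwa [List.nodup_reverse]
    · rwa [List.length_reverse]

/-- Two disjoint paths in a connected graph whose heads have all of the given neighbours on their
own paths can be combined to a path containing more vertices than there are neighbours. -/
theorem exists_isChain_of_two_isChain {G : SimpleGraph V} (hG : G.Preconnected) {s t : List V}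
    {a b : V} {M N : Finset V} (hs : s.IsChain G.Adj) (ht : t.IsChain G.Adj) (hn : (s ++ t).Nodup)
    (ha : s.head? = some a) (hb : t.head? = some b) (hM : ∀ w ∈ M, G.Adj a w ∧ w ∈ s)
    (hN : ∀ w ∈ N, G.Adj b w ∧ w ∈ t) :
    ∃ l : List V, l.IsChain G.Adj ∧ l.Nodup ∧ M.card + N.card + 2 ≤ l.length := by
  rw [List.nodup_append'] at hn
  obtain ⟨y, hy, w, hw, l, hlc, hln, hl⟩ := exists_isChain_connecting hG
    (S := {z | z ∈ s}) (T := {z | z ∈ t}) ⟨a, List.mem_of_mem_head? ha⟩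
    ⟨b, List.mem_of_mem_head? hb⟩ (Set.disjoint_left.2 fun z hz hz' => hn.2.2 hz hz')
  obtain ⟨s', hs'c, hs'n, hs's, hs'⟩ := exists_isChain_suffix_prefix hs hn.1 ha hM hy
  obtain ⟨t', ht'c, ht'n, ht't, ht'⟩ := exists_isChain_suffix_prefix ht hn.2.1 hb hN hw
  refine ⟨s' ++ y :: (l ++ w :: t'.reverse), ?_, ?_, ?_⟩
  · rw [List.isChain_split]
    refine ⟨hs'c, ?_⟩
    rw [← List.cons_append, List.isChain_split]
    refine ⟨hlc, ?_⟩
    rw [← isChain_reverse_adj] at ht'c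
    simpa using ht'c
  · have h1 : ((s' ++ [y]) ++ (l ++ (t' ++ [w]))).Nodup := by
      rw [List.nodup_append', List.nodup_append' (l₁ := l)]
      have h2 := hln
      rw [List.nodup_cons, List.nodup_append'] at h2
      refine ⟨hs'n, ⟨h2.2.1, ht'n, ?_⟩, ?_⟩
      · intro z hz hz'
        refine (hl z hz).2 ?_
        rcases List.mem_append.1 hz' with h | h
        · exact ht't z h
        · rw [List.mem_singleton.1 h]
          exact hw
      · intro z hz hz'
        have hzs : z ∈ s := by
          rcases List.mem_append.1 hz with h | h
          · exact hs's z h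
          · rw [List.mem_singleton.1 h]
            exact hy
        rcases List.mem_append.1 hz' with h | h
        · exact (hl z h).1 hzs
        · refine hn.2.2 hzs ?_
          rcases List.mem_append.1 h with h | h
          · exact ht't z h
          · rw [List.mem_singleton.1 h]
            exact hw
    refine List.Perm.nodup ?_ h1
    rw [List.append_assoc, List.singleton_append]
    refine List.Perm.append_left _ (List.Perm.cons _ (List.Perm.append_left _ ?_))
    refine List.perm_append_comm.trans ?_
    rw [List.singleton_append]
    exact List.Perm.cons _ (List.reverse_perm _).symm
  · simp
    omega

/-- **Kopylov's lemma** for paths. -/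
theorem adj_of_card_neighbors [Finite V] {k α β : ℕ} {G : SimpleGraph V} (hconn : G.Preconnected)
    (hG : PathFree k G) (hmax : ∀ a b, a ≠ b → ¬ G.Adj a b → ¬ PathFree k (G ⊔ edge a b))
    {A B : Finset V}
    (hA : ∀ a ∈ A, ∃ N : Finset V, N ⊆ A ∧ (∀ w ∈ N, G.Adj a w) ∧ α ≤ N.card)
    (hB : ∀ b ∈ B, ∃ N : Finset V, N ⊆ B ∧ (∀ w ∈ N, G.Adj b w) ∧ β ≤ N.card)
    (hk : k ≤ α + β + 1) {a b : V} (ha : a ∈ A) (hb : b ∈ B) (hab : a ≠ b) : G.Adj a b := by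
  classical
  have := Fintype.ofFinite V
  by_contra hadj
  have hbound : ∀ l : List (Option V), l.Nodup → l.length ≤ Fintype.card (Option V) :=
    fun l hl => hl.length_le_card
  -- Here d counts the cone vertices missed, so the least d gives a longest path over all
  -- non-adjacent pairs from A and B.
  let P : ℕ → Prop := fun d => ∃ l : List (Option V), ∃ a ∈ A, ∃ b ∈ B, a ≠ b ∧ ¬ G.Adj a b ∧
    l.IsChain (coneGraph G).Adj ∧ l.Nodup ∧ k + 1 ≤ l.length ∧
    l.head? = some (some a) ∧ l.getLast? = some (some b) ∧
    d + l.length = Fintype.card (Option V)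
  have hex : ∃ d, P d := by
    obtain ⟨l, h1, h2, h3, h4, h5⟩ := exists_isChain_coneGraph_of_not_adj hG hab (hmax a b hab hadj)
    exact ⟨Fintype.card (Option V) - l.length, l, a, ha, b, hb, hab, hadj, h1, h2, h3, h4, h5,
      Nat.sub_add_cancel (hbound l h2)⟩
  clear ha hb hab hadj a b
  obtain ⟨l, a, ha, b, hb, hab, hadj, hc, hn, hlk, hla, hlb, hd⟩ := Nat.find_spec hex
  -- If the ends are adjacent the path closes to a cycle on more than k vertices; if not, maximality
  -- is violated.
  have hlong : ∀ l' : List (Option V), ∀ a ∈ A, ∀ b ∈ B, a ≠ b →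
      l'.IsChain (coneGraph G).Adj → l'.Nodup → l.length < l'.length →
      l'.head? = some (some a) → l'.getLast? = some (some b) → False := by
    intro l' a' ha' b' hb' hab' hc' hn' hlen h1 h2
    by_cases hadj' : G.Adj a' b'
    · have := length_le_of_closed_isChain_coneGraph hG hc' hn' (by
        intro x hx y hy
        rw [h1] at hy
        rw [h2] at hx
        obtain rfl : some b' = x := by simpa using hx
        obtain rfl : some a' = y := by simpa using hy
        exact coneGraph_adj_some.2 hadj'.symm)
      omega
    · have := Nat.find_min' hex (m := Fintype.card (Option V) - l'.length)
        ⟨l', a', ha', b', hb', hab', hadj', hc', hn', by omega, h1, h2,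
        Nat.sub_add_cancel (hbound l' hn')⟩
      have h3 := hbound l' hn'
      omega
  have hamem : some a ∈ l := List.mem_of_mem_head? hla
  have hbmem : some b ∈ l := List.mem_of_mem_getLast? hlb
  have hnone : none ∈ l := by
    by_contra hnone
    have := length_le_of_closed_isChain_coneGraph hG (l := none :: l) ?_ ?_ ?_
    · simp at this
      omega
    · rw [List.isChain_cons]
      refine ⟨fun y hy => ?_, hc⟩
      rw [hla] at hy
      obtain rfl : some a = y := by simpa using hy
      exact coneGraph_adj_none.2 (by simp)
    · exact List.nodup_cons.2 ⟨hnone, hn⟩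
    · intro x hx y hy
      obtain rfl : none = y := by simpa using hy
      have hx' : some (some b) = some x := by
        rw [← hlb]
        cases l with
        | nil => simp at hamem
        | cons c l => simpa using hx
      obtain rfl : some b = x := by simpa using hx'
      exact (coneGraph_adj_none.2 (by simp)).symm
  obtain ⟨M, hMA, hMadj, hM⟩ := hA a ha
  obtain ⟨N, hNB, hNadj, hN⟩ := hB b hb
  have hMl : ∀ w ∈ M, some w ∈ l := by
    intro w hw
    by_contra hwl
    refine hlong (some w :: l) w (hMA hw) b hb ?_ ?_ ?_ ?_ ?_ ?_
    · rintro rfl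
      exact hwl hbmem
    · rw [List.isChain_cons]
      refine ⟨fun y hy => ?_, hc⟩
      rw [hla] at hy
      obtain rfl : some a = y := by simpa using hy
      exact coneGraph_adj_some.2 (hMadj w hw).symm
    · exact List.nodup_cons.2 ⟨hwl, hn⟩
    · simp
    · simp
    · rw [List.getLast?_cons, hlb]
      rfl
  have hNl : ∀ w ∈ N, some w ∈ l := by
    intro w hw
    by_contra hwl
    refine hlong (l ++ [some w]) a ha w (hNB hw) ?_ ?_ ?_ ?_ ?_ ?_
    · rintro rfl
      exact hwl hamem
    · rw [List.isChain_append]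
      refine ⟨hc, List.isChain_singleton _, fun x hx y hy => ?_⟩
      rw [hlb] at hx
      obtain rfl : some b = x := by simpa using hx
      obtain rfl : some w = y := by simpa using hy
      exact coneGraph_adj_some.2 (hNadj w hw)
    · rw [List.nodup_append']
      refine ⟨hn, by simp, ?_⟩
      simpa using hwl
    · simp
    · rw [List.head?_append, hla]
      rfl
    · simp
  -- no crossing neighbours
  have hcross : ∀ x ∈ Finset.insertNone M, ∀ y ∈ Finset.insertNone N, l.idxOf x ≤ l.idxOf y := by
    intro x hx y hy
    refine idxOf_le_idxOf_of_no_long_cycle (L := k + 1) (G := coneGraph G) ?_ hc hn hlk hla hlb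
      ?_ ?_ ?_ hx hy
    · intro l' h1 h2 h3
      exact Nat.lt_succ_of_le (length_le_of_closed_isChain_coneGraph hG h1 h2 h3)
    · rintro (_ | w) hw
      · exact ⟨(coneGraph_adj_none.2 (by simp)).symm, hnone⟩
      · have hw' := Finset.some_mem_insertNone.1 hw
        exact ⟨coneGraph_adj_some.2 (hMadj w hw'), hMl w hw'⟩
    · rintro (_ | w) hw
      · exact ⟨(coneGraph_adj_none.2 (by simp)).symm, hnone⟩
      · have hw' := Finset.some_mem_insertNone.1 hw
        exact ⟨coneGraph_adj_some.2 (hNadj w hw'), hNl w hw'⟩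
    -- The apex is a neighbour of both ends: (α + 1) + (β + 1) ≥ k + 1.
    · rw [Finset.card_insertNone, Finset.card_insertNone]
      omega
  -- As the apex is a neighbour of both ends, M lies before it and N after it; deleting it leaves
  -- two disjoint paths of G.
  obtain ⟨s, t, rfl⟩ := List.append_of_mem hnone
  have hn' := List.nodup_middle.1 hn
  rw [List.nodup_cons, List.mem_append, not_or] at hn'
  have hidx : (s ++ none :: t).idxOf none = s.length := by
    rw [List.idxOf_append_of_notMem hn'.1.1]
    simp
  obtain ⟨s, rfl⟩ := exists_eq_map_some hn'.1.1
  obtain ⟨t, rfl⟩ := exists_eq_map_some hn'.1.2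
  have hn'' := hn'.2
  rw [← List.map_append, List.nodup_map_iff (Option.some_injective V)] at hn''
  have hMs : ∀ w ∈ M, w ∈ s := by
    intro w hw
    by_contra hws
    have h1 := hcross (some w) (by simpa using hw) none (by simp)
    rw [hidx, List.idxOf_append_of_notMem (by simpa using hws)] at h1
    have h2 : List.idxOf (some w) (none :: t.map some) ≠ 0 := by
      rw [List.idxOf_cons_ne _ (by simp)]
      simp
    omega
  have hNt : ∀ w ∈ N, w ∈ t := by
    intro w hw
    by_contra hwt
    have hws : some w ∈ s.map some := by
      have := hNl w hw
      simp at this ⊢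
      tauto
    have h1 := hcross none (by simp) (some w) (by simpa using hw)
    rw [hidx, List.idxOf_append_of_mem hws] at h1
    have := List.idxOf_lt_length_of_mem hws
    omega
  have hsa : s.head? = some a := by
    cases s with
    | nil => simp at hla
    | cons c s => simpa using hla
  have htb : t.getLast? = some b := by
    rw [List.getLast?_append, List.getLast?_cons, List.getLast?_map] at hlb
    cases h : t.getLast? with
    | none => simp [h] at hlb
    | some c => simpa [h] using hlb
  have hs := isChain_coneGraph_map_some.1 hc.left_of_append
  have ht := isChain_coneGraph_map_some.1 hc.right_of_append.tail
  have hst : (s ++ t.reverse).Nodup :=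
    (List.Perm.append_left _ (List.reverse_perm _).symm).nodup hn''
  obtain ⟨m, hmc, hmn, hm⟩ := exists_isChain_of_two_isChain hconn hs (isChain_reverse_adj.2 ht)
    hst hsa (by simpa using htb)
    (fun w hw => ⟨hMadj w hw, hMs w hw⟩) (fun w hw => ⟨hNadj w hw, by simpa using hNt w hw⟩)
  have := pathFree_iff_forall_isChain.1 hG m hmc hmn
  omega

end Kopylov

/-! ### Degeneracy and the connected case -/

section Peeling

variable {V : Type*}

theorem PathFree.card_lt_of_isClique {k : ℕ} {G : SimpleGraph V} (hG : PathFree k G)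
    {C : Finset V} (hC : G.IsClique C) : C.card < k := by
  have h := pathFree_iff_forall_isChain.1 hG C.toList (List.Pairwise.isChain ?_) C.nodup_toList
  · simpa using h
  · refine List.Pairwise.imp_of_mem ?_ C.nodup_toList
    intro a b ha hb hab
    exact hC (by simpa using ha) (by simpa using hb) hab

/-- Connectedness gives an edge leaving C, which extends a path through all of C. -/
theorem PathFree.succ_card_lt_of_isClique {k : ℕ} {G : SimpleGraph V} (hG : PathFree k G)
    (hconn : G.Preconnected) {C : Finset V} (hC : G.IsClique C) (hne : C.Nonempty) {v : V}
    (hv : v ∉ C) : C.card + 1 < k := by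
  classical
  obtain ⟨y, hy, w, hw, l, hlc, hln, hl⟩ := exists_isChain_connecting hconn
    (S := {z | z ∈ C}) (T := {z | z ∉ C}) hne ⟨v, hv⟩
    (Set.disjoint_left.2 fun z hz hz' => hz' hz)
  have hl0 : l = [] := by
    cases l with
    | nil => rfl
    | cons z l => exact absurd (hl z (by simp)).2 (not_not.2 (hl z (by simp)).1)
  subst hl0
  simp only [List.nil_append, List.isChain_cons_cons] at hlc
  have hadj := hlc.1
  have h := pathFree_iff_forall_isChain.1 hG (w :: y :: (C.erase y).toList) ?_ ?_
  · have hpos : 0 < C.card := Finset.card_pos.2 hne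
    have : y ∈ C := hy
    simp [Finset.card_erase_of_mem this] at h
    omega
  · rw [List.isChain_cons_cons]
    refine ⟨hadj.symm, List.Pairwise.isChain ?_⟩
    have hnd : (y :: (C.erase y).toList).Nodup :=
      List.nodup_cons.2 ⟨by simp, (C.erase y).nodup_toList⟩
    have hmem : ∀ z ∈ y :: (C.erase y).toList, z ∈ C := by
      intro z hz
      rcases List.mem_cons.1 hz with rfl | h
      · exact hy
      · exact Finset.mem_of_mem_erase (Finset.mem_toList.1 h)
    refine List.Pairwise.imp_of_mem ?_ hnd
    intro a b ha hb hab
    exact hC (hmem a ha) (hmem b hb) hab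
  · refine List.nodup_cons.2 ⟨?_, List.nodup_cons.2 ⟨by simp, (C.erase y).nodup_toList⟩⟩
    intro h
    refine hw ?_
    rcases List.mem_cons.1 h with rfl | h
    · exact hy
    · exact Finset.mem_of_mem_erase (Finset.mem_toList.1 h)

theorem exists_maximal_pathFree [Finite V] {k : ℕ} {G : SimpleGraph V} (hG : PathFree k G) :
    ∃ H, G ≤ H ∧ PathFree k H ∧ ∀ a b, a ≠ b → ¬ H.Adj a b → ¬ PathFree k (H ⊔ edge a b) := by
  obtain ⟨H, hGH, hH⟩ := (Set.toFinite {H : SimpleGraph V | PathFree k H}).exists_le_maximal hG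
  refine ⟨H, hGH, hH.prop, fun a b hab hadj hfree => ?_⟩
  exact (H.lt_sup_edge a b hab hadj).not_ge (hH.le_of_ge hfree le_sup_left)

/-- A connected edge-maximal `P_k`-free graph on at least `k` vertices is `p`-degenerate outside
of a set of at most `k - 1 - p` vertices, for some `p`. -/
theorem exists_degenerate [Finite V] {k : ℕ} {G : SimpleGraph V} (hk : 4 ≤ k)
    (hconn : G.Preconnected)
    (hG : PathFree k G) (hmax : ∀ a b, a ≠ b → ¬ G.Adj a b → ¬ PathFree k (G ⊔ edge a b))
    (hcard : k ≤ Nat.card V) :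
    ∃ p, 1 ≤ p ∧ 2 * p + 2 ≤ k ∧ ∀ T : Finset V, k - 1 - p < T.card →
      ∃ v ∈ T, ∀ N ⊆ T, (∀ w ∈ N, G.Adj v w) → N.card ≤ p := by
  classical
  have := Fintype.ofFinite V
  by_contra! hcon
  have hcore : ∀ p, 1 ≤ p → 2 * p + 2 ≤ k → ∃ T : Finset V, k - 1 - p < T.card ∧
      ∀ v ∈ T, ∃ N : Finset V, N ⊆ T ∧ (∀ w ∈ N, G.Adj v w) ∧ p + 1 ≤ N.card := by
    intro p hp hpk
    obtain ⟨T, hT, h⟩ := hcon p hp hpk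
    exact ⟨T, hT, fun v hv => h v hv⟩
  obtain ⟨C, hC⟩ := G.maximumClique_exists
  -- This is the largest admissible p; as 2(p + 1) + 1 ≥ k, Kopylov's lemma makes S a clique.
  obtain ⟨S, hS, hSdeg⟩ := hcore ((k - 2) / 2) (by omega) (by omega)
  have hScl : G.IsClique S := by
    intro a ha b hb hab
    exact adj_of_card_neighbors hconn hG hmax hSdeg hSdeg (by omega) ha hb hab
  have hSC := hC.maximum S hScl
  have hCne : C.Nonempty := Finset.card_pos.1 (by omega)
  have hCk := hG.card_lt_of_isClique hC.isClique
  obtain ⟨v, hv⟩ : ∃ v, v ∉ C := by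
    by_contra! h
    have : C = Finset.univ := Finset.eq_univ_iff_forall.2 h
    rw [this, Finset.card_univ, ← Nat.card_eq_fintype_card] at hCk
    omega
  have hCk' := hG.succ_card_lt_of_isClique hconn hC.isClique hCne hv
  -- Now T is larger than C, and (|C| - 1) + (k - |C|) + 1 = k lets Kopylov's lemma join it to C.
  obtain ⟨T, hT, hTdeg⟩ := hcore (k - 1 - C.card) (by omega) (by omega)
  obtain ⟨w, hwT, hwC⟩ : ∃ w ∈ T, w ∉ C := by
    by_contra! h
    have := Finset.card_le_card (show T ⊆ C from h)
    omega
  have hCdeg : ∀ a ∈ C, ∃ N : Finset V, N ⊆ C ∧ (∀ w ∈ N, G.Adj a w) ∧ C.card - 1 ≤ N.card := by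
    intro a ha
    refine ⟨C.erase a, Finset.erase_subset _ _, fun w hw => ?_, (Finset.card_erase_of_mem ha).ge⟩
    exact hC.isClique ha (Finset.mem_of_mem_erase hw) (Finset.ne_of_mem_erase hw).symm
  have hins : G.IsClique (insert w C : Finset V) := by
    rw [Finset.coe_insert, isClique_insert_of_notMem (by simpa using hwC)]
    refine ⟨hC.isClique, fun b hb => ?_⟩
    exact (adj_of_card_neighbors hconn hG hmax hCdeg hTdeg (by omega) hb hwT
      (fun h => hwC (h ▸ hb))).symm
  have h := hC.maximum _ hins
  rw [Finset.card_insert_of_notMem hwC] at h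
  omega

/-- Deleting a vertex with at most p neighbours in S destroys at most C(p,t) cliques of order t+1;
stop at N vertices. -/
theorem ncard_cliques_subset_le [Finite V] {G : SimpleGraph V} {N p t : ℕ}
    (hG : ∀ T : Finset V, N < T.card → ∃ v ∈ T, ∀ M ⊆ T, (∀ w ∈ M, G.Adj v w) → M.card ≤ p)
    (S : Finset V) (hS : N ≤ S.card) :
    {c : Finset V | c ⊆ S ∧ G.IsNClique (t + 1) c}.ncard ≤
      N.choose (t + 1) + (S.card - N) * p.choose t := by
  classical
  obtain ⟨d, hd⟩ := Nat.exists_eq_add_of_le hS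
  induction d generalizing S with
  | zero =>
    rw [show S.card - N = 0 by omega, zero_mul, add_zero, ← show S.card = N by omega,
      ← Finset.card_powersetCard, ← Set.ncard_coe_finset]
    refine Set.ncard_le_ncard (fun c hc => ?_) (Finset.finite_toSet _)
    exact Finset.mem_coe.2 (Finset.mem_powersetCard.2 ⟨hc.1, hc.2.card_eq⟩)
  | succ d ih =>
    obtain ⟨v, hv, hvdeg⟩ := hG S (by omega)
    have hcard : (S.erase v).card = N + d := by
      rw [Finset.card_erase_of_mem hv]
      omega
    have h1 := ih (S.erase v) (by omega) hcard
    have hnb := hvdeg (S.filter (G.Adj v)) (Finset.filter_subset _ _) (by simp)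
    have hsub : {c : Finset V | c ⊆ S ∧ G.IsNClique (t + 1) c} ⊆
        {c : Finset V | c ⊆ S.erase v ∧ G.IsNClique (t + 1) c} ∪
          (((S.filter (G.Adj v)).powersetCard t).image (insert v) : Finset (Finset V)) := by
      rintro c ⟨hcS, hc⟩
      by_cases hvc : v ∈ c
      · right
        rw [Finset.mem_coe, Finset.mem_image]
        refine ⟨c.erase v, ?_, Finset.insert_erase hvc⟩
        rw [Finset.mem_powersetCard, Finset.card_erase_of_mem hvc, hc.card_eq]
        refine ⟨fun w hw => ?_, rfl⟩
        rw [Finset.mem_filter]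
        have hw' := Finset.mem_of_mem_erase hw
        exact ⟨hcS hw', hc.isClique hvc hw' (Finset.ne_of_mem_erase hw).symm⟩
      · left
        exact ⟨Finset.subset_erase.2 ⟨hcS, hvc⟩, hc⟩
    have h2 := (Set.ncard_le_ncard hsub (Set.toFinite _)).trans (Set.ncard_union_le _ _)
    rw [Set.ncard_coe_finset] at h2
    have h3 := (Finset.card_image_le (s := (S.filter (G.Adj v)).powersetCard t)
      (f := insert v)).trans_eq (Finset.card_powersetCard _ _)
    have h4 := Nat.choose_le_choose t hnb
    rw [show S.card - N = d + 1 by omega, add_mul, one_mul]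
    rw [show (S.erase v).card - N = d by omega] at h1
    omega

theorem numCliques_mono [Finite V] {t : ℕ} {G H : SimpleGraph V} (h : G ≤ H) :
    numCliques t G ≤ numCliques t H :=
  Set.ncard_le_ncard (cliqueSet_mono h) (Set.toFinite _)

theorem numCliques_lt_cliqueBound [Finite V] {t k : ℕ} {G : SimpleGraph V} (ht : 3 ≤ t)
    (htk : t < k) (hconn : G.Preconnected) (hG : PathFree k G) (hcard : k ≤ Nat.card V) :
    numCliques t G < cliqueBound t (k - 1) (Nat.card V) := by
  have := Fintype.ofFinite V
  obtain ⟨H, hGH, hH, hmax⟩ := exists_maximal_pathFree hG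
  refine (numCliques_mono hGH).trans_lt ?_
  obtain ⟨p, hp, hpk, hdeg⟩ := exists_degenerate (by omega) (hconn.mono hGH) hH hmax hcard
  refine lt_of_le_of_lt ?_ (peeling_bound_lt ht htk hp hpk hcard)
  obtain ⟨t, rfl⟩ : ∃ u, t = u + 1 := ⟨t - 1, by omega⟩
  have h := ncard_cliques_subset_le (t := t) hdeg Finset.univ (by
    rw [Finset.card_univ, ← Nat.card_eq_fintype_card]
    omega)
  rw [Finset.card_univ, ← Nat.card_eq_fintype_card] at h
  simpa [numCliques, cliqueSet] using h

end Peeling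

/-! ### Counting cliques -/

section Counting

variable {V W : Type*}

theorem ncard_cliques_range {G : SimpleGraph V} {H : SimpleGraph W} (f : G ↪g H) (t : ℕ) :
    {c : Finset W | H.IsNClique t c ∧ ∀ x ∈ c, x ∈ Set.range f}.ncard = numCliques t G := by
  classical
  rw [numCliques,
    ← Set.ncard_image_of_injective (G.cliqueSet t) (Finset.map_injective f.toEmbedding)]
  congr 1
  ext c
  constructor
  · rintro ⟨hc, hr⟩
    obtain ⟨d, -, rfl⟩ := Finset.subset_map_iff.1 (show c ⊆ (c.preimage f
      f.injective.injOn).map f.toEmbedding from fun x hx => by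
        obtain ⟨y, rfl⟩ := hr x hx
        exact Finset.mem_map.2 ⟨y, by simpa using hx, rfl⟩)
    refine ⟨d, ⟨?_, by simpa using hc.card_eq⟩, rfl⟩
    intro a ha b hb hab
    refine f.map_adj_iff.1 (hc.isClique ?_ ?_ (f.injective.ne hab))
    · simpa using ha
    · simpa using hb
  · rintro ⟨d, hd, rfl⟩
    refine ⟨⟨?_, by simpa using hd.card_eq⟩, ?_⟩
    · intro x hx y hy hxy
      simp only [Finset.coe_map, Set.mem_image] at hx hy
      obtain ⟨a, ha, rfl⟩ := hx
      obtain ⟨b, hb, rfl⟩ := hy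
      exact f.map_adj_iff.2 (hd.isClique ha hb fun h => hxy (h ▸ rfl))
    · intro x hx
      obtain ⟨a, -, rfl⟩ := Finset.mem_map.1 hx
      exact ⟨a, rfl⟩

theorem numCliques_congr {G : SimpleGraph V} {H : SimpleGraph W} (e : G ≃g H) (t : ℕ) :
    numCliques t G = numCliques t H := by
  rw [← ncard_cliques_range e.toEmbedding, numCliques]
  congr 1
  ext c
  simp only [mem_cliqueSet_iff, Set.mem_ofPred_eq]
  exact ⟨fun h => h.1, fun h => ⟨h, fun x _ => e.surjective x⟩⟩

theorem numCliques_sum [Finite V] [Finite W] (G : SimpleGraph V) (H : SimpleGraph W) {t : ℕ}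
    (ht : 1 ≤ t) : numCliques t (G ⊕g H) = numCliques t G + numCliques t H := by
  rw [← ncard_cliques_range (Embedding.sumInl : G ↪g G ⊕g H),
    ← ncard_cliques_range (Embedding.sumInr : H ↪g G ⊕g H), ← Set.ncard_union_eq, numCliques]
  · congr 1
    ext c
    simp only [mem_cliqueSet_iff, Set.mem_union, Set.mem_ofPred_eq, ← and_or_left]
    refine ⟨fun hc => ⟨hc, ?_⟩, fun hc => hc.1⟩
    obtain ⟨x, hx⟩ : c.Nonempty := Finset.card_pos.1 (by rw [hc.card_eq]; omega)
    rcases x with a | b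
    · left
      rintro (a' | b') hy
      · exact ⟨a', rfl⟩
      · exact absurd (hc.isClique hx hy (by simp)) (by simp)
    · right
      rintro (a' | b') hy
      · exact absurd (hc.isClique hx hy (by simp)) (by simp)
      · exact ⟨b', rfl⟩
  · rw [Set.disjoint_left]
    rintro c ⟨hc, h1⟩ ⟨-, h2⟩
    obtain ⟨x, hx⟩ : c.Nonempty := Finset.card_pos.1 (by rw [hc.card_eq]; omega)
    obtain ⟨a, rfl⟩ := h1 x hx
    obtain ⟨b, hb⟩ := h2 _ hx
    cases hb

theorem numCliques_le_choose [Finite V] (G : SimpleGraph V) (t : ℕ) :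
    numCliques t G ≤ (Nat.card V).choose t := by
  have := Fintype.ofFinite V
  rw [Nat.card_eq_fintype_card, ← Finset.card_univ, ← Finset.card_powersetCard,
    ← Set.ncard_coe_finset]
  refine Set.ncard_le_ncard (fun c hc => ?_) (Finset.finite_toSet _)
  exact Finset.mem_coe.2 (Finset.mem_powersetCard.2 ⟨Finset.subset_univ _, hc.card_eq⟩)

theorem numCliques_top [Finite V] (t : ℕ) :
    numCliques t (⊤ : SimpleGraph V) = (Nat.card V).choose t := by
  have := Fintype.ofFinite V
  rw [Nat.card_eq_fintype_card, ← Finset.card_univ, ← Finset.card_powersetCard,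
    ← Set.ncard_coe_finset, numCliques]
  congr 1
  ext c
  simp [isNClique_iff, IsClique, Set.Pairwise]

/-- Every t-set is a clique, and every pair lies in a t-set. -/
theorem eq_top_of_numCliques_eq [Finite V] {G : SimpleGraph V} {t : ℕ} (ht : 2 ≤ t)
    (htV : t ≤ Nat.card V) (h : numCliques t G = (Nat.card V).choose t) : G = ⊤ := by
  classical
  have := Fintype.ofFinite V
  have hsub : G.cliqueSet t ⊆ (⊤ : SimpleGraph V).cliqueSet t := cliqueSet_mono le_top
  have heq := Set.eq_of_subset_of_ncard_le hsub
    (show numCliques t _ ≤ numCliques t _ by rw [numCliques_top, h]) (Set.toFinite _)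
  ext a b
  rw [top_adj]
  refine ⟨fun h => h.ne, fun hab => ?_⟩
  obtain ⟨c, hc1, -, hc2⟩ := Finset.exists_subsuperset_card_eq (Finset.subset_univ {a, b})
    (n := t) (by rwa [Finset.card_pair hab])
    (by rwa [Finset.card_univ, ← Nat.card_eq_fintype_card])
  have hc : c ∈ (⊤ : SimpleGraph V).cliqueSet t := by
    rw [mem_cliqueSet_iff, isNClique_iff]
    exact ⟨fun x _ y _ hxy => hxy, hc2⟩
  rw [← heq] at hc
  exact hc.isClique (hc1 (by simp)) (hc1 (by simp)) hab

end Counting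

/-! ### Disjoint unions -/

section Structure

variable {V W : Type*}

theorem pathFree_congr {k : ℕ} {G : SimpleGraph V} {H : SimpleGraph W} (e : G ≃g H) :
    PathFree k G ↔ PathFree k H :=
  free_congr_right e

theorem PathFree.induce {k : ℕ} {G : SimpleGraph V} (hG : PathFree k G) (S : Set V) :
    PathFree k (G.induce S) := by
  rintro ⟨f⟩
  exact hG ⟨(Embedding.induce S).toCopy.comp f⟩

theorem pathFree_of_card_lt [Finite V] {k : ℕ} (G : SimpleGraph V) (h : Nat.card V < k) :
    PathFree k G := by
  have := Fintype.ofFinite V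
  rw [pathFree_iff_forall_isChain]
  intro l _ hn
  rw [Nat.card_eq_fintype_card] at h
  exact hn.length_le_card.trans_lt h

theorem isChain_sum_iff_map {G : SimpleGraph V} {H : SimpleGraph W} {l : List (V ⊕ W)}
    (hl : l.IsChain (G ⊕g H).Adj) :
    (∃ m : List V, l = m.map Sum.inl) ∨ ∃ m : List W, l = m.map Sum.inr := by
  induction l with
  | nil => exact Or.inl ⟨[], rfl⟩
  | cons x l ih =>
    rcases ih hl.tail with ⟨m, rfl⟩ | ⟨m, rfl⟩ <;> cases m <;> rcases x with a | b
    · exact Or.inl ⟨[a], rfl⟩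
    · exact Or.inr ⟨[b], rfl⟩
    · exact Or.inl ⟨a :: _ :: _, rfl⟩
    · simp at hl
    · exact Or.inl ⟨[a], rfl⟩
    · exact Or.inr ⟨[b], rfl⟩
    · simp at hl
    · exact Or.inr ⟨b :: _ :: _, rfl⟩

theorem PathFree.sum {k : ℕ} {G : SimpleGraph V} {H : SimpleGraph W} (hG : PathFree k G)
    (hH : PathFree k H) : PathFree k (G ⊕g H) := by
  rw [pathFree_iff_forall_isChain] at *
  intro l hc hn
  rcases isChain_sum_iff_map hc with ⟨m, rfl⟩ | ⟨m, rfl⟩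
  · rw [List.isChain_map] at hc
    simpa using hG m (by simpa using hc) hn.of_map
  · rw [List.isChain_map] at hc
    simpa using hH m (by simpa using hc) hn.of_map

theorem nonempty_iso_induce_sum {G : SimpleGraph V} {S : Set V}
    (hS : ∀ a ∈ S, ∀ b ∉ S, ¬ G.Adj a b) :
    Nonempty (G.induce S ⊕g G.induce Sᶜ ≃g G) := by
  classical
  refine ⟨⟨Equiv.Set.sumCompl S, ?_⟩⟩
  rintro (⟨a, ha⟩ | ⟨a, ha⟩) (⟨b, hb⟩ | ⟨b, hb⟩)
  · simp
  · simpa using hS a ha b hb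
  · simpa [G.adj_comm] using hS b hb a ha
  · simp

theorem nonempty_iso_cliquesUnion_zero (k : ℕ) (L : SimpleGraph W) :
    Nonempty (L ≃g cliquesUnion 0 k L) := by
  refine ⟨⟨(Equiv.emptySum _ _).symm, ?_⟩⟩
  simp [cliquesUnion]

theorem nonempty_iso_cliquesUnion_succ (q k : ℕ) (L : SimpleGraph W) :
    Nonempty (completeGraph (Fin (k - 1)) ⊕g cliquesUnion q k L ≃g cliquesUnion (q + 1) k L) := by
  let f : Fin (k - 1) ⊕ ((Fin q × Fin (k - 1)) ⊕ W) → (Fin (q + 1) × Fin (k - 1)) ⊕ W :=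
    Sum.elim (fun a => Sum.inl (0, a))
      (Sum.elim (fun x => Sum.inl (x.1.succ, x.2)) Sum.inr)
  have hf : Function.Bijective f := by
    constructor
    · rintro (a | ⟨i, a⟩ | w) (b | ⟨j, b⟩ | w') h <;>
        simp [f, Fin.succ_ne_zero, (Fin.succ_ne_zero _).symm] at h ⊢ <;> exact h
    · rintro (⟨i, a⟩ | w)
      · refine Fin.cases ?_ (fun i => ?_) i
        · exact ⟨Sum.inl a, rfl⟩
        · exact ⟨Sum.inr (Sum.inl (i, a)), rfl⟩
      · exact ⟨Sum.inr (Sum.inr w), rfl⟩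
  refine ⟨⟨Equiv.ofBijective f hf, ?_⟩⟩
  rintro (a | ⟨i, a⟩ | w) (b | ⟨j, b⟩ | w') <;>
    simp [f, cliquesUnion, disjointCopies, Fin.succ_ne_zero, (Fin.succ_ne_zero _).symm]

theorem numCliques_cliquesUnion [Finite W] {t : ℕ} (ht : 1 ≤ t) (q k : ℕ) (L : SimpleGraph W) :
    numCliques t (cliquesUnion q k L) = q * (k - 1).choose t + numCliques t L := by
  induction q with
  | zero =>
    obtain ⟨e⟩ := nonempty_iso_cliquesUnion_zero k L
    rw [← numCliques_congr e]
    simp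
  | succ q ih =>
    obtain ⟨e⟩ := nonempty_iso_cliquesUnion_succ q k L
    rw [← numCliques_congr e, numCliques_sum _ _ ht, ih, completeGraph, numCliques_top,
      Nat.card_fin]
    ring

theorem pathFree_cliquesUnion [Finite W] {k : ℕ} (hk : 1 ≤ k) (q : ℕ) (L : SimpleGraph W)
    (hW : Nat.card W < k) : PathFree k (cliquesUnion q k L) := by
  induction q with
  | zero =>
    obtain ⟨e⟩ := nonempty_iso_cliquesUnion_zero k L
    exact (pathFree_congr e).1 (pathFree_of_card_lt L hW)
  | succ q ih =>
    obtain ⟨e⟩ := nonempty_iso_cliquesUnion_succ q k L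
    exact (pathFree_congr e).1 ((pathFree_of_card_lt _ (by rw [Nat.card_fin]; omega)).sum ih)

end Structure

/-! ### The bound and the equality case -/

section Extremal

/-- `S` is the vertex set of a connected component of `G` that is a complete graph on `m`
vertices, provided that `m` is positive. -/
def IsIsolatedClique {V : Type*} (G : SimpleGraph V) (m : ℕ) (S : Set V) : Prop :=
  S.ncard = m ∧ G.IsClique S ∧ ∀ a ∈ S, ∀ b ∉ S, ¬ G.Adj a b

theorem IsIsolatedClique.image_val {V : Type*} {G : SimpleGraph V} {m : ℕ} {T : Set V}
    (hT : ∀ a ∈ T, ∀ b ∉ T, ¬ G.Adj a b) {S : Set T} (hS : IsIsolatedClique (G.induce T) m S) :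
    IsIsolatedClique G m (Subtype.val '' S) := by
  refine ⟨?_, ?_, ?_⟩
  · rw [Set.ncard_image_of_injective _ Subtype.val_injective]
    exact hS.1
  · rintro _ ⟨a, ha, rfl⟩ _ ⟨b, hb, rfl⟩ hab
    exact hS.2.1 ha hb fun h => hab (h ▸ rfl)
  · rintro _ ⟨a, ha, rfl⟩ b hb hab
    by_cases hbT : b ∈ T
    · exact hS.2.2 a ha ⟨b, hbT⟩ (fun h => hb ⟨_, h, rfl⟩) hab
    · exact hT a a.2 b hbT hab

/-- In a disconnected graph equality passes to both sides of the cut; were both sides smaller than k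
- 1, superadditivity would be strict. -/
theorem numCliques_le_cliqueBound_and {t k : ℕ} (ht : 3 ≤ t) (htk : t < k) {V : Type*} [Finite V]
    (G : SimpleGraph V) (hG : PathFree k G) :
    numCliques t G ≤ cliqueBound t (k - 1) (Nat.card V) ∧
      (numCliques t G = cliqueBound t (k - 1) (Nat.card V) → k - 1 ≤ Nat.card V →
        ∃ S, IsIsolatedClique G (k - 1) S) := by
  generalize hn : Nat.card V = n
  induction n using Nat.strong_induction_on generalizing V with
  | _ n ih =>
  subst hn
  by_cases hconn : G.Preconnected
  · rcases le_or_gt k (Nat.card V) with hk | hk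
    · have h := numCliques_lt_cliqueBound ht htk hconn hG hk
      exact ⟨h.le, fun h' => absurd h' h.ne⟩
    · have hbd : cliqueBound t (k - 1) (Nat.card V) = (Nat.card V).choose t := by
        rcases eq_or_lt_of_le (show Nat.card V ≤ k - 1 by omega) with h | h
        · rw [h, cliqueBound_self (by omega) (by omega)]
        · exact cliqueBound_of_lt h
      rw [hbd]
      refine ⟨numCliques_le_choose G t, fun h hk' => ⟨Set.univ, ?_, ?_, by simp⟩⟩
      · rw [Set.ncard_univ]
        omega
      · rw [eq_top_of_numCliques_eq (by omega) (by omega) h]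
        exact fun x _ y _ hxy => hxy
  · obtain ⟨u, v, huv⟩ : ∃ u v, ¬ G.Reachable u v := by
      by_contra! h
      exact hconn h
    let S : Set V := {w | G.Reachable u w}
    have hS : ∀ a ∈ S, ∀ b ∉ S, ¬ G.Adj a b := fun a ha b hb hab =>
      hb (Reachable.trans ha hab.reachable)
    have hS' : ∀ a ∈ Sᶜ, ∀ b ∉ Sᶜ, ¬ G.Adj a b := fun a ha b hb hab =>
      hS b (not_not.1 hb) a ha hab.symm
    obtain ⟨e⟩ := nonempty_iso_induce_sum hS
    have hcard : Nat.card S + Nat.card (Sᶜ : Set V) = Nat.card V := by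
      rw [← Nat.card_sum]
      exact Nat.card_congr e.toEquiv
    have h1 : 0 < Nat.card S := Nat.card_pos_iff.2 ⟨⟨u, Reachable.refl u⟩, inferInstance⟩
    have h2 : 0 < Nat.card (Sᶜ : Set V) := Nat.card_pos_iff.2 ⟨⟨v, huv⟩, inferInstance⟩
    obtain ⟨hle1, heq1⟩ := ih _ (by omega) (G.induce S) (hG.induce S) rfl
    obtain ⟨hle2, heq2⟩ := ih _ (by omega) (G.induce Sᶜ) (hG.induce Sᶜ) rfl
    have hadd := cliqueBound_add (t := t) (K := k - 1) (a := Nat.card S)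
      (b := Nat.card (Sᶜ : Set V)) (by omega) (by omega)
    rw [← numCliques_congr e, numCliques_sum _ _ (by omega), ← hcard]
    refine ⟨by omega, fun h hk => ?_⟩
    rcases le_or_gt (k - 1) (Nat.card S) with hk1 | hk1
    · obtain ⟨T, hT⟩ := heq1 (by omega) hk1
      exact ⟨_, hT.image_val hS⟩
    · rcases le_or_gt (k - 1) (Nat.card (Sᶜ : Set V)) with hk2 | hk2
      · obtain ⟨T, hT⟩ := heq2 (by omega) hk2
        exact ⟨_, hT.image_val hS'⟩
      · have := cliqueBound_add_strict (t := t) (by omega) (by omega) hk1 hk2 hk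
        omega

/-- Removing an isolated K_{k-1} lowers count and bound alike by C(k-1,t), so the rest still attains
equality; the last r vertices carry L. -/
theorem exists_iso_cliquesUnion {t k : ℕ} (ht : 3 ≤ t) (htk : t < k) {q r : ℕ} (hr : r < k - 1)
    {V : Type*} [Finite V] (hV : Nat.card V = q * (k - 1) + r) {G : SimpleGraph V}
    (hG : PathFree k G) (h : numCliques t G = cliqueBound t (k - 1) (Nat.card V)) :
    ∃ L : SimpleGraph (Fin r), Nonempty (G ≃g cliquesUnion q k L) := by
  induction q generalizing V with
  | zero =>
    have e : V ≃ Fin r := Finite.equivFinOfCardEq (by simpa using hV)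
    obtain ⟨e'⟩ := nonempty_iso_cliquesUnion_zero k (G.map e)
    exact ⟨G.map e, ⟨(Iso.map e G).trans e'⟩⟩
  | succ q ih =>
    have hV' : Nat.card V = q * (k - 1) + r + (k - 1) := by rw [hV]; ring
    obtain ⟨S, hSc, hScl, hS⟩ := (numCliques_le_cliqueBound_and ht htk G hG).2 h (by omega)
    obtain ⟨e⟩ := nonempty_iso_induce_sum hS
    have hcardS : Nat.card S = k - 1 := by rw [← hSc, Nat.card_coe_set_eq]
    have hcard : Nat.card (Sᶜ : Set V) = q * (k - 1) + r := by
      have : Nat.card S + Nat.card (Sᶜ : Set V) = Nat.card V := by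
        rw [← Nat.card_sum]
        exact Nat.card_congr e.toEquiv
      omega
    have htop : G.induce S = ⊤ := induce_eq_top.2 hScl
    obtain ⟨L, ⟨e'⟩⟩ := ih hcard (hG.induce Sᶜ) (by
      have h1 := numCliques_congr e t
      rw [numCliques_sum _ _ (by omega), htop, numCliques_top, hcardS, h, hV,
        cliqueBound_eq hr] at h1
      rw [hcard, cliqueBound_eq hr]
      rw [add_mul] at h1
      omega)
    obtain ⟨e''⟩ := nonempty_iso_cliquesUnion_succ q k L
    have eS : G.induce S ≃g completeGraph (Fin (k - 1)) := by
      rw [htop]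
      exact Iso.completeGraph (Finite.equivFinOfCardEq hcardS)
    exact ⟨L, ⟨e.symm.trans ((Iso.sumCongr eS e').trans e'')⟩⟩

end Extremal

theorem theorem1p5 (n t k q r : ℕ) (hn : 0 < n) (ht : 3 ≤ t) (htk : t < k)
    (hnqr : n = q * (k - 1) + r) (hr : r ≤ k - 2)
    {V : Type*} [Fintype V] (hV : Fintype.card V = n) (G : SimpleGraph V) :
    (PathFree k G →
      numCliques t G ≤ numCliques t (cliquesUnion q k (completeGraph (Fin r)))) ∧
    (t ≤ r →
      ((PathFree k G ∧
          numCliques t G = numCliques t (cliquesUnion q k (completeGraph (Fin r)))) ↔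
        Nonempty (G ≃g cliquesUnion q k (completeGraph (Fin r))))) ∧
    (r < t →
      (IsPathExtremal t k G ↔
        ∃ L : SimpleGraph (Fin r), Nonempty (G ≃g cliquesUnion q k L))) := by
  have hr' : r < k - 1 := by omega
  have hVq : Nat.card V = q * (k - 1) + r := by rw [Nat.card_eq_fintype_card, hV, hnqr]
  have hbound : cliqueBound t (k - 1) (Nat.card V) = q * (k - 1).choose t + r.choose t := by
    rw [hVq, cliqueBound_eq hr']
  have hfree : ∀ L : SimpleGraph (Fin r), PathFree k (cliquesUnion q k L) := fun L =>
    pathFree_cliquesUnion (by omega) q L (by rw [Nat.card_fin]; omega)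
  have hcomplete : numCliques t (cliquesUnion q k (completeGraph (Fin r))) =
      cliqueBound t (k - 1) (Nat.card V) := by
    rw [hbound, numCliques_cliquesUnion (by omega), completeGraph, numCliques_top, Nat.card_fin]
  refine ⟨fun hG => ?_, fun htr => ⟨?_, ?_⟩, fun hrt => ?_⟩
  · rw [hcomplete]
    exact (numCliques_le_cliqueBound_and ht htk G hG).1
  · rintro ⟨hG, h⟩
    rw [hcomplete] at h
    obtain ⟨L, ⟨e⟩⟩ := exists_iso_cliquesUnion ht htk hr' hVq hG h
    have hL : numCliques t L = r.choose t := by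
      rw [numCliques_congr e, numCliques_cliquesUnion (by omega), hbound] at h
      omega
    have htop : L = ⊤ :=
      eq_top_of_numCliques_eq (t := t) (by omega) (by rwa [Nat.card_fin]) (by rwa [Nat.card_fin])
    subst htop
    exact ⟨e⟩
  · rintro ⟨e⟩
    exact ⟨(pathFree_congr e).2 (hfree _), numCliques_congr e t⟩
  · have hcount : ∀ L : SimpleGraph (Fin r), numCliques t (cliquesUnion q k L) =
        cliqueBound t (k - 1) (Nat.card V) := by
      intro L
      have h0 : r.choose t = 0 := Nat.choose_eq_zero_of_lt hrt
      have hL := numCliques_le_choose L t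
      rw [Nat.card_fin, h0] at hL
      rw [hbound, numCliques_cliquesUnion (by omega), h0, Nat.le_zero.1 hL]
    constructor
    · rintro ⟨hG, hmax⟩
      have hcard : Nat.card ((Fin q × Fin (k - 1)) ⊕ Fin r) = Nat.card V := by
        rw [hVq]
        simp
      -- Extremality compares graphs on V only, so a competitor is transported there; as r < t, any
      -- L would do.
      let e := Iso.map ((Finite.equivFinOfCardEq hcard).trans (Finite.equivFin V).symm)
        (cliquesUnion q k (⊥ : SimpleGraph (Fin r)))
      refine exists_iso_cliquesUnion ht htk hr' hVq hG ?_
      refine le_antisymm (numCliques_le_cliqueBound_and ht htk G hG).1 ?_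
      rw [← hcount ⊥, numCliques_congr e]
      exact hmax _ ((pathFree_congr e).1 (hfree ⊥))
    · rintro ⟨L, ⟨e⟩⟩
      refine ⟨(pathFree_congr e).2 (hfree L), fun H hH => ?_⟩
      rw [numCliques_congr e, hcount L]
      exact (numCliques_le_cliqueBound_and ht htk H hH).1
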